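/- Let $X$ be a complex Banach space, let $L(X)$ be the algebra of bounded linear operators on $X$, and let $T,R\in L(X)$. Write $\alpha(T)=\dim\ker T$, $\beta(T)=\operatorname{codim} T(X)$ and $\operatorname{ind}(T)=\alpha(T)-\beta(T)$. The operator $T$ is upper (resp. lower) semi-Fredholm if $T(X)$ is closed and $\alpha(T)<\infty$ (resp. $\beta(T)<\infty$), and Fredholm if it is both. It is upper semi-Weyl if it is upper semi-Fredholm with $\operatorname{ind}(T)\le 0$, lower semi-Weyl if it is lower semi-Fredholm with $\operatorname{ind}(T)\ge 0$, Weyl if it is Fredholm with $\operatorname{ind}(T)=0$, and Browder if it is Fredholm and its ascent and descent are equal and finite. For each of these classes the corresponding spectrum of $T$ is the set of all $\lambda\in\mathbb C$ such that $T-\lambda I$ is not in the class; $\sigma_e,\sigma_w,\sigma_{uf},\sigma_{uw},\sigma_{lf},\sigma_{lw}$ denote the Fredholm (essential), Weyl, upper semi-Fredholm, upper semi-Weyl, lower semi-Fredholm and lower semi-Weyl spectrum. The operator $R$ is Riesz if $R-\lambda I$ is Browder for every $\lambda\in\mathbb C\setminus\{0\}$. Assume that $R$ is a Riesz operator. Then: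 (i) If $T$ commutes with $RT$ and with $TR$, and $T$ is Fredholm, then $\sigma_e(T)=\sigma_e(T+R)$ and $\sigma_w(T)=\sigma_w(T+R)$. (ii) If $T$ commutes with $TR$ (that is, $TRT=T^2R$) and $T$ is upper semi-Fredholm, then $\sigma_{uf}(T)=\sigma_{uf}(T+R)$ and $\sigma_{uw}(T)=\sigma_{uw}(T+R)$. (iii) If $T$ commutes with $RT$ (that is, $TRT=RT^2$) and $T$ is lower semi-Fredholm, then $\sigma_{lf}(T)=\sigma_{lf}(T+R)$ and $\sigma_{lw}(T)=\sigma_{lw}(T+R)$. -/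

import Mathlib

open scoped ENNReal

noncomputable section

namespace ContinuousLinearMap

variable {X : Type*} [NormedAddCommGroup X] [NormedSpace ℂ X]

/-- `α(T)`: the dimension of the kernel of `T`, with value `⊤` if it is infinite. -/
def nullity (T : X →L[ℂ] X) : ℕ∞ :=
  Cardinal.toENat (Module.rank ℂ (LinearMap.ker (T : X →ₗ[ℂ] X)))

/-- `β(T)`: the codimension of the range of `T`, with value `⊤` if it is infinite. -/
def deficiency (T : X →L[ℂ] X) : ℕ∞ :=
  Cardinal.toENat (Module.rank ℂ (X ⧸ LinearMap.range (T : X →ₗ[ℂ] X)))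

/-- The index `α(T) - β(T)`, an extended integer. It is used only for operators with
`α(T) < ∞` or `β(T) < ∞`, so that the indeterminate form `∞ - ∞` does not occur. -/
def extIndex (T : X →L[ℂ] X) : EReal :=
  ((T.nullity : ℝ≥0∞) : EReal) - ((T.deficiency : ℝ≥0∞) : EReal)

/-- The ascent of `T`: the least `n` with `ker T ^ n = ker T ^ (n + 1)`, and `⊤` if there is none. -/
def opAscent (T : X →L[ℂ] X) : ℕ∞ :=
  ⨅ (n : ℕ) (_ : LinearMap.ker ((T ^ n : X →L[ℂ] X) : X →ₗ[ℂ] X) =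
    LinearMap.ker ((T ^ (n + 1) : X →L[ℂ] X) : X →ₗ[ℂ] X)), (n : ℕ∞)

/-- The descent of `T`: the least `n` with `range T ^ n = range T ^ (n + 1)`,
and `⊤` if there is none. -/
def opDescent (T : X →L[ℂ] X) : ℕ∞ :=
  ⨅ (n : ℕ) (_ : LinearMap.range ((T ^ n : X →L[ℂ] X) : X →ₗ[ℂ] X) =
    LinearMap.range ((T ^ (n + 1) : X →L[ℂ] X) : X →ₗ[ℂ] X)), (n : ℕ∞)

/-- `T` is upper semi-Fredholm: finite-dimensional kernel and closed range. -/
structure IsUpperSemiFredholm (T : X →L[ℂ] X) : Prop where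
  nullity_lt_top : T.nullity < ⊤
  isClosed_range : IsClosed (Set.range T)

/-- `T` is lower semi-Fredholm: range closed and of finite codimension. -/
structure IsLowerSemiFredholm (T : X →L[ℂ] X) : Prop where
  deficiency_lt_top : T.deficiency < ⊤
  isClosed_range : IsClosed (Set.range T)

/-- `T` is upper semi-Weyl: upper semi-Fredholm with index `≤ 0` (possibly `-∞`). -/
def IsUpperSemiWeyl (T : X →L[ℂ] X) : Prop :=
  T.IsUpperSemiFredholm ∧ T.extIndex ≤ 0

/-- `T` is lower semi-Weyl: lower semi-Fredholm with index `≥ 0` (possibly `+∞`). -/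
def IsLowerSemiWeyl (T : X →L[ℂ] X) : Prop :=
  T.IsLowerSemiFredholm ∧ 0 ≤ T.extIndex

/-- `T` is Weyl: Fredholm with index `0`. -/
def IsWeyl (T : X →L[ℂ] X) : Prop :=
  T.IsFredholm ∧ T.extIndex = 0

/-- `T` is Browder: Fredholm with finite (and then equal) ascent and descent. -/
def IsBrowder (T : X →L[ℂ] X) : Prop :=
  T.IsFredholm ∧ T.opAscent = T.opDescent ∧ T.opAscent < ⊤

/-- `T` is a Riesz operator: `T - λ I` is Browder for every nonzero complex `λ`. -/
def IsRiesz (T : X →L[ℂ] X) : Prop :=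
  ∀ z : ℂ, z ≠ 0 → (T - z • ContinuousLinearMap.id ℂ X).IsBrowder

/-- The essential (Fredholm) spectrum `σ_e(T)`. -/
def essSpectrum (T : X →L[ℂ] X) : Set ℂ :=
  {z | ¬ (T - z • ContinuousLinearMap.id ℂ X).IsFredholm}

/-- The Weyl spectrum `σ_w(T)`. -/
def weylSpectrum (T : X →L[ℂ] X) : Set ℂ :=
  {z | ¬ (T - z • ContinuousLinearMap.id ℂ X).IsWeyl}

/-- The upper semi-Fredholm spectrum `σ_uf(T)`. -/
def upperSemiFredholmSpectrum (T : X →L[ℂ] X) : Set ℂ :=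
  {z | ¬ (T - z • ContinuousLinearMap.id ℂ X).IsUpperSemiFredholm}

/-- The lower semi-Fredholm spectrum `σ_lf(T)`. -/
def lowerSemiFredholmSpectrum (T : X →L[ℂ] X) : Set ℂ :=
  {z | ¬ (T - z • ContinuousLinearMap.id ℂ X).IsLowerSemiFredholm}

/-- The upper semi-Weyl spectrum `σ_uw(T)`. -/
def upperSemiWeylSpectrum (T : X →L[ℂ] X) : Set ℂ :=
  {z | ¬ (T - z • ContinuousLinearMap.id ℂ X).IsUpperSemiWeyl}

/-- The lower semi-Weyl spectrum `σ_lw(T)`. -/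
def lowerSemiWeylSpectrum (T : X →L[ℂ] X) : Set ℂ :=
  {z | ¬ (T - z • ContinuousLinearMap.id ℂ X).IsLowerSemiWeyl}

end ContinuousLinearMap

end

/-! The commutation hypotheses make `T` and `R` commute modulo finite-rank operators. If `T`
commutes with `T * R`, then `T * (T * R - R * T) = 0`, so the commutator maps into the
finite-dimensional `ker T`. If `T` commutes with `R * T`, the commutator vanishes on `range T`,
which has finite codimension. Replacing `T` by `S = T - z` does not change the commutator.

A Riesz operator has spectrum at most `{0}` modulo the closure of the finite-rank operators, so by
Gelfand's formula some power `R ^ n` is within `ε ^ n` of finite rank, for each `ε > 0`. Modulo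
finite rank, `S ^ n - (-R) ^ n` is a multiple of `S + R` on either side. If `S` is bounded below by
`c` on a subspace of finite codimension, then `S ^ n` is so with `c ^ n`, which beats `(-R) ^ n`
when `ε = c`; hence `S + R` is upper semi-Fredholm. The lower case is the dual argument, with
preimages of controlled norm.

For the Weyl classes, the index is constant along the path `S + t • R` of Fredholm operators; if `S
+ R` is only semi-Fredholm, its infinite index has the required sign. Perturbing back by `-R` gives
the reverse inclusions. -/

noncomputable section

open Filter Topology

/-! ### Normed quotients by closed two-sided ideals -/

namespace Ideal.Quotient

variable {A : Type*} [NormedRing A] (I : Ideal A) [I.IsTwoSided]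

/-- The quotient of a normed ring by a closed two-sided ideal is a normed ring. -/
abbrev normedRingOfIsTwoSided [IsClosed (I : Set A)] : NormedRing (A ⧸ I) :=
  { Submodule.Quotient.normedAddCommGroup I, Ideal.Quotient.ring I with
    norm_mul_le := fun x y ↦ by
      have h : ∀ ε > 0, ‖x * y‖ ≤ (‖x‖ + ε) * (‖y‖ + ε) := by
        intro ε hε
        obtain ⟨a, rfl, ha⟩ := Submodule.Quotient.norm_mk_lt x hε
        obtain ⟨b, rfl, hb⟩ := Submodule.Quotient.norm_mk_lt y hε
        calc _ ≤ ‖a * b‖ := Submodule.Quotient.norm_mk_le I (a * b)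
          _ ≤ ‖a‖ * ‖b‖ := norm_mul_le a b
          _ ≤ _ := by gcongr
      have ht : Tendsto (fun ε : ℝ ↦ (‖x‖ + ε) * (‖y‖ + ε)) (𝓝[>] 0) (𝓝 (‖x‖ * ‖y‖)) := by
        have : Continuous fun ε : ℝ ↦ (‖x‖ + ε) * (‖y‖ + ε) := by fun_prop
        simpa using (this.tendsto 0).mono_left nhdsWithin_le_nhds
      exact ge_of_tendsto ht (eventually_nhdsWithin_of_forall h) }

/-- The quotient of a normed algebra by a closed two-sided ideal is a normed algebra. -/
abbrev normedAlgebraOfIsTwoSided [IsClosed (I : Set A)] (𝕜 : Type*) [NormedField 𝕜]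
    [NormedAlgebra 𝕜 A] :
    letI := normedRingOfIsTwoSided I
    NormedAlgebra 𝕜 (A ⧸ I) :=
  letI := normedRingOfIsTwoSided I
  { Ideal.Quotient.algebra 𝕜 with
    norm_smul_le := (Submodule.Quotient.normedSpace I 𝕜).norm_smul_le }

end Ideal.Quotient

/-! ### Riesz operators modulo finite rank -/

namespace ContinuousLinearMap

variable {X : Type*} [NormedAddCommGroup X] [NormedSpace ℂ X]

variable (X) in
/-- The ideal of bounded operators of finite rank. -/
def finiteRankIdeal : Ideal (X →L[ℂ] X) where
  carrier := {F | (F : X →ₗ[ℂ] X).HasFiniteRange}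
  add_mem' := fun hF hG ↦ hF.add hG
  zero_mem' := LinearMap.HasFiniteRange.zero
  smul_mem' := fun A _ hF ↦ hF.comp_left (A : X →ₗ[ℂ] X)

lemma mem_finiteRankIdeal {F : X →L[ℂ] X} :
    F ∈ finiteRankIdeal X ↔ (F : X →ₗ[ℂ] X).HasFiniteRange := Iff.rfl

instance : (finiteRankIdeal X).IsTwoSided where
  mul_mem_of_left {F} B hF := by
    rw [mem_finiteRankIdeal] at hF ⊢
    exact hF.comp_right (B : X →ₗ[ℂ] X)

instance : (finiteRankIdeal X).closure.IsTwoSided where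
  mul_mem_of_left {_} B hF :=
    map_mem_closure (f := fun A ↦ A * B) (continuous_mul_const B) hF fun _ hG ↦
      (finiteRankIdeal X).mul_mem_right B hG

instance : IsClosed ((finiteRankIdeal X).closure : Set (X →L[ℂ] X)) := by
  rw [Ideal.coe_closure]; exact isClosed_closure

lemma finiteRankIdeal_le_closure : finiteRankIdeal X ≤ (finiteRankIdeal X).closure :=
  fun _ h ↦ subset_closure h

/-- The image of `R` modulo finite-rank operators is asymptotically quasinilpotent: powers of `R`
are approximated by finite-rank operators faster than any geometric sequence. -/
def IsEssentiallyQuasinilpotent (R : X →L[ℂ] X) : Prop :=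
  ∀ ε > 0, ∃ n > 0, ∃ F ∈ finiteRankIdeal X, ‖R ^ n - F‖ < ε ^ n

lemma IsFredholm.exists_mul_sub_one_mem {A : X →L[ℂ] X} (hA : A.IsFredholm) :
    ∃ V : X →L[ℂ] X, V * A - 1 ∈ finiteRankIdeal X ∧ A * V - 1 ∈ finiteRankIdeal X := by
  obtain ⟨V, hV⟩ := hA.exists_isQuasiInverse
  exact ⟨V, LinearMap.FiniteRangeSetoid.equiv_iff_hasFiniteRange.mp hV.1,
    LinearMap.FiniteRangeSetoid.equiv_iff_hasFiniteRange.mp hV.2⟩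

lemma IsFredholm.of_mul_sub_one_mem {A V : X →L[ℂ] X} (h₁ : V * A - 1 ∈ finiteRankIdeal X)
    (h₂ : A * V - 1 ∈ finiteRankIdeal X) : A.IsFredholm :=
  .of_isQuasiInverse (v := V) ⟨LinearMap.FiniteRangeSetoid.equiv_iff_hasFiniteRange.mpr h₁,
    LinearMap.FiniteRangeSetoid.equiv_iff_hasFiniteRange.mpr h₂⟩

/-- Fredholm operators are invertible modulo finite rank, so the class of `R` in the Banach algebra
modulo the closed ideal has zero spectral radius. Gelfand's formula bounds its powers, and the bound
lifts to operators. -/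
theorem IsEssentiallyQuasinilpotent.of_forall_isFredholm [CompleteSpace X] {R : X →L[ℂ] X}
    (hR : ∀ z : ℂ, z ≠ 0 → (R - z • ContinuousLinearMap.id ℂ X).IsFredholm) :
    R.IsEssentiallyQuasinilpotent := by
  intro ε hε
  let J := (finiteRankIdeal X).closure
  let : NormedRing ((X →L[ℂ] X) ⧸ J) := Ideal.Quotient.normedRingOfIsTwoSided J
  let : NormedAlgebra ℂ ((X →L[ℂ] X) ⧸ J) := Ideal.Quotient.normedAlgebraOfIsTwoSided J ℂ
  have : CompleteSpace ((X →L[ℂ] X) ⧸ J) := Submodule.Quotient.completeSpace J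
  let r : (X →L[ℂ] X) ⧸ J := Ideal.Quotient.mk J R
  have hspec : spectrum ℂ r ⊆ {0} := by
    intro z hz
    by_contra hz0
    obtain ⟨V, h₁, h₂⟩ := (hR z hz0).exists_mul_sub_one_mem
    apply hz
    have e : algebraMap ℂ ((X →L[ℂ] X) ⧸ J) z - r
        = -Ideal.Quotient.mk J (R - z • ContinuousLinearMap.id ℂ X) := by
      rw [← map_neg, neg_sub, map_sub]
      rfl
    rw [spectrum.mem_resolventSet_iff, e, IsUnit.neg_iff, isUnit_iff_exists]
    refine ⟨Ideal.Quotient.mk J V, ?_, ?_⟩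
    · rw [← map_mul, ← map_one (Ideal.Quotient.mk J), Ideal.Quotient.eq]
      exact finiteRankIdeal_le_closure h₂
    · rw [← map_mul, ← map_one (Ideal.Quotient.mk J), Ideal.Quotient.eq]
      exact finiteRankIdeal_le_closure h₁
  have hrad : spectralRadius ℂ r = 0 := by
    rw [spectralRadius]
    simp only [ENNReal.iSup_eq_zero]
    intro z hz
    simp [show z = 0 from hspec hz]
  have ht := spectrum.pow_norm_pow_one_div_tendsto_nhds_spectralRadius r
  rw [hrad] at ht
  have hev := ht.eventually (gt_mem_nhds (ENNReal.ofReal_pos.mpr hε))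
  obtain ⟨n, hn, hn0⟩ := (hev.and (eventually_gt_atTop 0)).exists
  refine ⟨n, hn0, ?_⟩
  have hlt : ‖r ^ n‖ < ε ^ n := by
    have h := (ENNReal.ofReal_lt_ofReal_iff hε).mp hn
    rw [one_div] at h
    rw [← Real.rpow_inv_natCast_pow (norm_nonneg (r ^ n)) hn0.ne']
    gcongr
  have hlt' : ‖(Submodule.Quotient.mk (R ^ n) : (X →L[ℂ] X) ⧸ J)‖ < ε ^ n := by
    have : r ^ n = Submodule.Quotient.mk (R ^ n) := (map_pow (Ideal.Quotient.mk J) R n).symm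
    rwa [← this]
  obtain ⟨B, hB, hBn⟩ := Submodule.Quotient.norm_mk_lt
    (Submodule.Quotient.mk (R ^ n) : (X →L[ℂ] X) ⧸ J) (sub_pos.mpr hlt')
  have hmem : R ^ n - B ∈ closure (finiteRankIdeal X : Set (X →L[ℂ] X)) :=
    (Submodule.Quotient.eq J).mp hB.symm
  -- The slack left by the lift `B` absorbs the passage from the closure to a genuine finite-rank
  -- operator.
  obtain ⟨F, hF, hFd⟩ := Metric.mem_closure_iff.mp hmem (ε ^ n - ‖B‖) (by linarith)
  refine ⟨F, hF, ?_⟩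
  rw [dist_eq_norm] at hFd
  calc ‖R ^ n - F‖ = ‖B + (R ^ n - B - F)‖ := by congr 1; abel
    _ ≤ ‖B‖ + ‖R ^ n - B - F‖ := norm_add_le _ _
    _ < ε ^ n := by linarith

lemma IsEssentiallyQuasinilpotent.smul {R : X →L[ℂ] X} (hR : R.IsEssentiallyQuasinilpotent)
    (z : ℂ) : (z • R).IsEssentiallyQuasinilpotent := by
  intro ε hε
  obtain ⟨n, hn, F, hF, h⟩ := hR (ε / (‖z‖ + 1)) (by positivity)
  refine ⟨n, hn, z ^ n • F, hF.smul _, ?_⟩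
  rw [smul_pow, ← smul_sub, norm_smul, norm_pow]
  calc ‖z‖ ^ n * ‖R ^ n - F‖ ≤ (‖z‖ + 1) ^ n * ‖R ^ n - F‖ := by gcongr; linarith
    _ < (‖z‖ + 1) ^ n * (ε / (‖z‖ + 1)) ^ n := by gcongr
    _ = ε ^ n := by rw [← mul_pow, mul_div_cancel₀ _ (by positivity)]

lemma IsRiesz.isEssentiallyQuasinilpotent [CompleteSpace X] {R : X →L[ℂ] X} (hR : R.IsRiesz) :
    R.IsEssentiallyQuasinilpotent :=
  .of_forall_isFredholm fun z hz ↦ (hR z hz).1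

end ContinuousLinearMap

/-! ### Upper semi-Fredholm operators: lower bounds on subspaces of finite codimension -/

namespace Submodule

variable {K V W : Type*} [Field K] [AddCommGroup V] [Module K V] [AddCommGroup W] [Module K W]

lemma CoFG.comap {S : Submodule K W} (hS : S.CoFG) (f : V →ₗ[K] W) : (S.comap f).CoFG := by
  have h : S.comap f = LinearMap.ker (S.mkQ ∘ₗ f) := by rw [LinearMap.ker_comp, ker_mkQ]
  rw [h]
  exact CoFG.ker _

end Submodule

namespace ContinuousLinearMap

variable {X : Type*} [NormedAddCommGroup X] [NormedSpace ℂ X]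

lemma nullity_lt_top_iff {A : X →L[ℂ] X} :
    A.nullity < ⊤ ↔ FiniteDimensional ℂ (LinearMap.ker (A : X →ₗ[ℂ] X)) := by
  rw [nullity, Cardinal.toENat_lt_top, Module.rank_lt_aleph0_iff]

lemma deficiency_lt_top_iff {A : X →L[ℂ] X} :
    A.deficiency < ⊤ ↔ (LinearMap.range (A : X →ₗ[ℂ] X)).CoFG := by
  rw [deficiency, Cardinal.toENat_lt_top, Module.rank_lt_aleph0_iff]

lemma ker_coFG_of_mem_finiteRankIdeal {F : X →L[ℂ] X} (hF : F ∈ finiteRankIdeal X) :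
    (LinearMap.ker (F : X →ₗ[ℂ] X)).CoFG :=
  LinearMap.HasFiniteRange.cofg_ker hF

/-- `A` is bounded below by `c` on a subspace of finite codimension. -/
def IsEssentiallyBoundedBelow (A : X →L[ℂ] X) (c : ℝ) : Prop :=
  ∃ M : Submodule ℂ X, M.CoFG ∧ ∀ x ∈ M, c * ‖x‖ ≤ ‖A x‖

lemma IsEssentiallyBoundedBelow.pow {A : X →L[ℂ] X} {c : ℝ} (hc : 0 ≤ c)
    (hA : A.IsEssentiallyBoundedBelow c) (n : ℕ) : (A ^ n).IsEssentiallyBoundedBelow (c ^ n) := by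
  obtain ⟨M, hM, hMc⟩ := hA
  induction n with
  | zero => exact ⟨⊤, .top, fun x _ ↦ by simp⟩
  | succ n ih =>
    obtain ⟨N, hN, hNc⟩ := ih
    refine ⟨N ⊓ M.comap ((A ^ n : X →L[ℂ] X) : X →ₗ[ℂ] X), hN.inf (hM.comap _), ?_⟩
    rintro x ⟨hxN, hxM⟩
    calc c ^ (n + 1) * ‖x‖ = c * (c ^ n * ‖x‖) := by ring
      _ ≤ c * ‖(A ^ n) x‖ := by gcongr; exact hNc x hxN
      _ ≤ ‖A ((A ^ n) x)‖ := hMc _ hxM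
      _ = ‖(A ^ (n + 1)) x‖ := by rw [pow_succ']; rfl

/-- On a closed complement of the kernel, `A` is injective with the same closed range, hence bounded
below by the open mapping theorem. -/
lemma IsUpperSemiFredholm.exists_isEssentiallyBoundedBelow [CompleteSpace X] {A : X →L[ℂ] X}
    (hA : A.IsUpperSemiFredholm) : ∃ c > 0, A.IsEssentiallyBoundedBelow c := by
  have := nullity_lt_top_iff.mp hA.nullity_lt_top
  obtain ⟨M, hM⟩ := (Submodule.ClosedComplemented.of_finiteDimensional
    (LinearMap.ker (A : X →ₗ[ℂ] X))).exists_isTopCompl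
  have hMcl : IsClosed (M : Set X) := hM.symm.isClosed
  have : CompleteSpace M := hMcl.completeSpace_coe
  have hinj : Function.Injective (A.domRestrict M) := by
    rw [← coe_coe, ← LinearMap.ker_eq_bot, toLinearMap_domRestrict, LinearMap.ker_domRestrict, ← Submodule.disjoint_iff_comap_eq_bot]
    exact hM.isCompl.disjoint.symm
  have hrange : Set.range (A.domRestrict M) = Set.range A := by
    ext y
    constructor
    · rintro ⟨x, rfl⟩; exact ⟨x, rfl⟩
    · rintro ⟨x, rfl⟩
      obtain ⟨k, hk, m, hm, rfl⟩ := Submodule.mem_sup.mp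
        (hM.isCompl.sup_eq_top ▸ Submodule.mem_top : x ∈ _ ⊔ M)
      refine ⟨⟨m, hm⟩, ?_⟩
      have : A k = 0 := hk
      simp [this]
  obtain ⟨K, hK⟩ := antilipschitz_of_injective_of_isClosed_range (A.domRestrict M) hinj
    (hrange ▸ hA.isClosed_range)
  refine ⟨((K : ℝ) + 1)⁻¹, by positivity, M, ?_, fun x hx ↦ ?_⟩
  · exact Submodule.FG.cofg_of_isCompl hM.isCompl (Submodule.FG.of_finite)
  · have h := hK.le_mul_norm (map_zero _) (⟨x, hx⟩ : M)
    rw [inv_mul_le_iff₀ (by positivity)]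
    calc ‖x‖ ≤ K * ‖A x‖ := h
      _ ≤ _ := by gcongr; linarith

/-- The lower bound extends to the closure of the subspace. The restriction there is a closed
embedding, and the kernel meets this closure trivially. -/
lemma IsEssentiallyBoundedBelow.isUpperSemiFredholm [CompleteSpace X] {A : X →L[ℂ] X} {c : ℝ}
    (hc : 0 < c) (hA : A.IsEssentiallyBoundedBelow c) : A.IsUpperSemiFredholm := by
  obtain ⟨M, hM, hMc⟩ := hA
  let N := M.topologicalClosure
  have hN : N.CoFG := hM.of_le M.le_topologicalClosure
  have hNcl : IsClosed (N : Set X) := M.isClosed_topologicalClosure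
  have hNc : ∀ x ∈ N, c * ‖x‖ ≤ ‖A x‖ := fun x hx ↦ by
    have hcl : IsClosed {x : X | c * ‖x‖ ≤ ‖A x‖} := isClosed_le (by fun_prop) (by fun_prop)
    exact closure_minimal (fun x hx ↦ hMc x hx) hcl hx
  have hanti : AntilipschitzWith (Real.toNNReal c)⁻¹ (A.domRestrict N) := by
    refine AddMonoidHomClass.antilipschitz_of_bound _ fun x ↦ ?_
    rw [NNReal.coe_inv, Real.coe_toNNReal c hc.le, ← div_eq_inv_mul, le_div_iff₀' hc]
    exact hNc x x.2
  have : CompleteSpace N := hNcl.completeSpace_coe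
  have hemb := hanti.isClosedEmbedding (A.domRestrict N).uniformContinuous
  have hcl := (A.isStrictMap_isClosed_range_iff_restrict N hNcl).mpr
    ⟨hemb.isEmbedding.isStrictMap, hemb.isClosed_range⟩
  refine ⟨nullity_lt_top_iff.mpr ?_, hcl.2⟩
  rw [← Submodule.fg_iff_finiteDimensional]
  refine hN.fg_of_disjoint (Submodule.disjoint_def.mpr fun x hx hxN ↦ ?_)
  have h0 : A x = 0 := hx
  have := hNc x hxN
  rw [h0, norm_zero] at this
  exact norm_le_zero_iff.mp (by nlinarith)

/-- In the quotient ring `S` and `-R` commute, so the geometric sum factors the difference of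
powers; the same `Q` serves on both sides. -/
lemma exists_pow_sub_neg_pow_eq {S R : X →L[ℂ] X}
    (h : S * R - R * S ∈ finiteRankIdeal X) (n : ℕ) : ∃ Q : X →L[ℂ] X,
      S ^ n - (-R) ^ n - Q * (S + R) ∈ finiteRankIdeal X ∧
      S ^ n - (-R) ^ n - (S + R) * Q ∈ finiteRankIdeal X := by
  let π := Ideal.Quotient.mk (finiteRankIdeal X)
  have hcomm : Commute (π S) (π (-R)) := by
    rw [map_neg]
    refine Commute.neg_right ?_
    rw [commute_iff_eq, ← map_mul, ← map_mul]
    exact Ideal.Quotient.eq.mpr h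
  refine ⟨∑ i ∈ Finset.range n, S ^ i * (-R) ^ (n - 1 - i), ?_, ?_⟩
  · rw [← Ideal.Quotient.eq, ← sub_neg_eq_add S R]
    simpa only [map_sub, map_mul, map_sum, map_pow] using (hcomm.geom_sum₂_mul n).symm
  · rw [← Ideal.Quotient.eq, ← sub_neg_eq_add S R]
    simpa only [map_sub, map_mul, map_sum, map_pow] using (hcomm.mul_geom_sum₂ n).symm

lemma IsEssentiallyQuasinilpotent.neg {R : X →L[ℂ] X} (hR : R.IsEssentiallyQuasinilpotent) :
    (-R).IsEssentiallyQuasinilpotent := by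
  simpa using hR.smul (-1)

theorem IsUpperSemiFredholm.add_of_isEssentiallyQuasinilpotent [CompleteSpace X]
    {S R : X →L[ℂ] X} (hS : S.IsUpperSemiFredholm) (hR : R.IsEssentiallyQuasinilpotent)
    (hSR : S * R - R * S ∈ finiteRankIdeal X) : (S + R).IsUpperSemiFredholm := by
  obtain ⟨c, hc, hSc⟩ := hS.exists_isEssentiallyBoundedBelow
  -- With `ε = c`, the lower bound `c ^ n` of `S ^ n` exceeds `‖(-R) ^ n - F‖`. Below, `F` and the
  -- error `G` are removed by restricting to their kernels.
  obtain ⟨n, -, F, hF, hlt⟩ := hR.neg c hc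
  obtain ⟨M, hM, hMc⟩ := hSc.pow hc.le n
  obtain ⟨Q, hQ, -⟩ := exists_pow_sub_neg_pow_eq hSR n
  set G := S ^ n - (-R) ^ n - Q * (S + R) with hG
  refine IsEssentiallyBoundedBelow.isUpperSemiFredholm
    (c := (c ^ n - ‖(-R) ^ n - F‖) / (‖Q‖ + 1))
    (div_pos (sub_pos.mpr hlt) (by positivity))
    ⟨M ⊓ LinearMap.ker (F : X →ₗ[ℂ] X) ⊓ LinearMap.ker (G : X →ₗ[ℂ] X),
      (hM.inf (ker_coFG_of_mem_finiteRankIdeal hF)).inf (ker_coFG_of_mem_finiteRankIdeal hQ), ?_⟩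
  rintro x ⟨⟨hxM, hxF⟩, hxG⟩
  have hFx : F x = 0 := hxF
  have hGx : (S ^ n) x - ((-R) ^ n) x = Q ((S + R) x) := sub_eq_zero.mp hxG
  rw [div_mul_eq_mul_div, div_le_iff₀ (by positivity)]
  have h₁ : ‖((-R) ^ n) x‖ ≤ ‖(-R) ^ n - F‖ * ‖x‖ := by
    simpa [hFx] using ((-R) ^ n - F).le_opNorm x
  calc (c ^ n - ‖(-R) ^ n - F‖) * ‖x‖ = c ^ n * ‖x‖ - ‖(-R) ^ n - F‖ * ‖x‖ := by ring
    _ ≤ ‖(S ^ n) x‖ - ‖((-R) ^ n) x‖ := sub_le_sub (hMc x hxM) h₁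
    _ ≤ ‖(S ^ n) x - ((-R) ^ n) x‖ := norm_sub_norm_le _ _
    _ = ‖Q ((S + R) x)‖ := by rw [hGx]
    _ ≤ ‖Q‖ * ‖(S + R) x‖ := Q.le_opNorm _
    _ ≤ ‖(S + R) x‖ * (‖Q‖ + 1) := by nlinarith [norm_nonneg ((S + R) x)]

end ContinuousLinearMap

/-! ### Lower semi-Fredholm operators: preimages up to a finite-dimensional space -/

namespace ContinuousLinearMap

variable {X : Type*} [NormedAddCommGroup X] [NormedSpace ℂ X]

/-- Up to a finite-dimensional subspace, every `y` has a preimage under `A` of norm at most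
`C * ‖y‖`. -/
def IsEssentiallyOpen (A : X →L[ℂ] X) (C : ℝ) : Prop :=
  ∃ Z : Submodule ℂ X, FiniteDimensional ℂ Z ∧ ∀ y, ∃ x, y - A x ∈ Z ∧ ‖x‖ ≤ C * ‖y‖

lemma IsEssentiallyOpen.pow {A : X →L[ℂ] X} {C : ℝ} (hC : 0 ≤ C)
    (hA : A.IsEssentiallyOpen C) (n : ℕ) : (A ^ n).IsEssentiallyOpen (C ^ n) := by
  obtain ⟨Z, hZ, hZC⟩ := hA
  induction n with
  | zero => exact ⟨⊥, inferInstance, fun y ↦ ⟨y, by simp⟩⟩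
  | succ n ih =>
    obtain ⟨W, hW, hWC⟩ := ih
    refine ⟨W ⊔ Z.map ((A ^ n : X →L[ℂ] X) : X →ₗ[ℂ] X), inferInstance, fun y ↦ ?_⟩
    obtain ⟨x, hx, hxn⟩ := hWC y
    obtain ⟨x', hx', hxn'⟩ := hZC x
    refine ⟨x', ?_, ?_⟩
    · have e : y - (A ^ (n + 1)) x' = (y - (A ^ n) x) + (A ^ n) (x - A x') := by
        rw [map_sub, pow_succ]
        change y - (A ^ n) (A x') = _
        abel
      rw [e]
      exact Submodule.add_mem_sup hx (Submodule.mem_map_of_mem hx')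
    · calc ‖x'‖ ≤ C * ‖x‖ := hxn'
        _ ≤ C * (C ^ n * ‖y‖) := by gcongr
        _ = C ^ (n + 1) * ‖y‖ := by ring

/-- The map `(x, z) ↦ A x + z` on `X × Z`. -/
def coprodSubtype (A : X →L[ℂ] X) (Z : Submodule ℂ X) : X × Z →L[ℂ] X := A.coprod Z.subtypeL

lemma coprodSubtype_surjective {A : X →L[ℂ] X} {Z : Submodule ℂ X}
    (h : LinearMap.range (A : X →ₗ[ℂ] X) ⊔ Z = ⊤) :
    Function.Surjective (coprodSubtype A Z) := by
  intro y
  obtain ⟨_, ⟨x, rfl⟩, z, hz, rfl⟩ := Submodule.mem_sup.mp (h ▸ Submodule.mem_top : y ∈ _ ⊔ Z)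
  exact ⟨(x, ⟨z, hz⟩), rfl⟩

lemma exists_finiteDimensional_isCompl_range {A : X →L[ℂ] X}
    (hA : (LinearMap.range (A : X →ₗ[ℂ] X)).CoFG) : ∃ Z : Submodule ℂ X,
      FiniteDimensional ℂ Z ∧ IsCompl (LinearMap.range (A : X →ₗ[ℂ] X)) Z := by
  obtain ⟨Z, hZ⟩ := Submodule.exists_isCompl (LinearMap.range (A : X →ₗ[ℂ] X))
  exact ⟨Z, .of_fg (hA.fg_of_isCompl hZ), hZ⟩

lemma range_coFG_of_sub_mem {A B : X →L[ℂ] X} (hAB : A - B ∈ finiteRankIdeal X)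
    (hA : (LinearMap.range (A : X →ₗ[ℂ] X)).CoFG) :
    (LinearMap.range (B : X →ₗ[ℂ] X)).CoFG := by
  obtain ⟨Z, hZ, hc⟩ := exists_finiteDimensional_isCompl_range hA
  refine Submodule.FG.cofg_of_codisjoint
    (S := LinearMap.range ((A - B : X →L[ℂ] X) : X →ₗ[ℂ] X) ⊔ Z) (codisjoint_iff.mpr ?_)
    ((mem_finiteRankIdeal.mp hAB).sup ((Submodule.fg_iff_finiteDimensional Z).mpr hZ))
  rw [eq_top_iff, ← hc.sup_eq_top]
  refine sup_le ?_ (le_sup_right.trans le_sup_left)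
  rintro _ ⟨x, rfl⟩
  exact Submodule.mem_sup.mpr
    ⟨(A - B) x, Submodule.mem_sup_left ⟨x, rfl⟩, B x, ⟨x, rfl⟩, by simp⟩

variable [CompleteSpace X]

/-- With `Z` an algebraic complement of the range, `(x, z) ↦ A x + z` is a quotient map by the open
mapping theorem, and the range pulls back to the closed set `z = 0`. -/
lemma isClosed_range_of_coFG {A : X →L[ℂ] X}
    (hA : (LinearMap.range (A : X →ₗ[ℂ] X)).CoFG) : IsClosed (Set.range A) := by
  obtain ⟨Z, hZ, hc⟩ := exists_finiteDimensional_isCompl_range hA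
  have : CompleteSpace Z := FiniteDimensional.complete ℂ Z
  rw [← ((coprodSubtype A Z).isQuotientMap (coprodSubtype_surjective hc.sup_eq_top)).isClosed_preimage]
  have e : coprodSubtype A Z ⁻¹' Set.range A = {p | p.2 = 0} := by
    ext ⟨x, z⟩
    constructor
    · rintro ⟨w, hw⟩
      have hz : (z : X) = A (w - x) := by
        rw [map_sub, hw]
        simp [coprodSubtype]
      exact Subtype.ext (Submodule.disjoint_def.mp hc.disjoint z ⟨w - x, hz.symm⟩ z.2)
    · intro hz
      exact ⟨x, by simp [coprodSubtype, show z = 0 from hz]⟩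
  rw [e]
  exact isClosed_eq continuous_snd continuous_const

lemma isLowerSemiFredholm_iff {A : X →L[ℂ] X} :
    A.IsLowerSemiFredholm ↔ (LinearMap.range (A : X →ₗ[ℂ] X)).CoFG :=
  ⟨fun h ↦ deficiency_lt_top_iff.mp h.deficiency_lt_top,
    fun h ↦ ⟨deficiency_lt_top_iff.mpr h, isClosed_range_of_coFG h⟩⟩

lemma IsLowerSemiFredholm.exists_isEssentiallyOpen {A : X →L[ℂ] X}
    (hA : A.IsLowerSemiFredholm) : ∃ C > 0, A.IsEssentiallyOpen C := by
  obtain ⟨Z, hZ, hc⟩ := exists_finiteDimensional_isCompl_range (isLowerSemiFredholm_iff.mp hA)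
  have : CompleteSpace Z := FiniteDimensional.complete ℂ Z
  obtain ⟨C, hC, h⟩ := (coprodSubtype A Z).exists_preimage_norm_le
    (coprodSubtype_surjective hc.sup_eq_top)
  refine ⟨C, hC, Z, hZ, fun y ↦ ?_⟩
  obtain ⟨⟨x, z⟩, rfl, hxz⟩ := h y
  exact ⟨x, by simp [coprodSubtype], (le_max_left _ _).trans hxz⟩

/-- A perturbation of an essentially open map by a map of small norm has range of finite
codimension. -/
lemma IsEssentiallyOpen.range_sub_coFG {A K : X →L[ℂ] X} {C : ℝ} (hA : A.IsEssentiallyOpen C)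
    (hC : 0 ≤ C) (hK : ‖K‖ * C < 1) : (LinearMap.range ((A - K : X →L[ℂ] X) : X →ₗ[ℂ] X)).CoFG := by
  obtain ⟨Z, hZ, hZC⟩ := hA
  choose g hgZ hgC using hZC
  set q := ‖K‖ * C
  have hq0 : 0 ≤ q := by positivity
  refine Submodule.FG.cofg_of_codisjoint (S := Z) (codisjoint_iff.mpr ?_)
    ((Submodule.fg_iff_finiteDimensional Z).mpr hZ)
  rw [eq_top_iff]
  intro y _
  -- Neumann iteration: `u k` is, modulo `Z`, the error left after `k` corrections, and it decays
  -- like `q ^ k`.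
  let u : ℕ → X := fun k ↦ (fun w ↦ K (g w))^[k] y
  have hu_succ : ∀ k, u (k + 1) = K (g (u k)) := fun k ↦ Function.iterate_succ_apply' _ _ _
  have hu : ∀ k, ‖u k‖ ≤ q ^ k * ‖y‖ := by
    intro k
    induction k with
    | zero => simp [u]
    | succ k ih =>
      rw [hu_succ]
      calc ‖K (g (u k))‖ ≤ ‖K‖ * (C * ‖u k‖) := K.le_opNorm_of_le (hgC _)
        _ ≤ ‖K‖ * (C * (q ^ k * ‖y‖)) := by gcongr
        _ = q ^ (k + 1) * ‖y‖ := by simp only [q]; ring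
  have hsum : Summable fun k ↦ g (u k) := by
    refine Summable.of_norm_bounded
      (g := fun k ↦ C * (q ^ k * ‖y‖)) ?_ fun k ↦ (hgC _).trans (by gcongr; exact hu k)
    exact ((summable_geometric_of_lt_one hq0 hK).mul_right _).mul_left _
  have hmem : ∀ n, y - (A - K) (∑ k ∈ Finset.range n, g (u k)) - u n ∈ Z := by
    intro n
    induction n with
    | zero => simp [u]
    | succ n ih =>
      have e : y - (A - K) (∑ k ∈ Finset.range (n + 1), g (u k)) - u (n + 1) =
          (y - (A - K) (∑ k ∈ Finset.range n, g (u k)) - u n) + (u n - A (g (u n))) := by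
        rw [Finset.sum_range_succ, map_add, hu_succ, sub_apply A K (g (u n))]
        abel
      rw [e]
      exact Z.add_mem ih (hgZ _)
  have hu0 : Tendsto u atTop (𝓝 0) := by
    refine squeeze_zero_norm hu ?_
    simpa using (tendsto_pow_atTop_nhds_zero_of_lt_one hq0 hK).mul_const ‖y‖
  have hlim : Tendsto (fun n ↦ y - (A - K) (∑ k ∈ Finset.range n, g (u k)) - u n) atTop
      (𝓝 (y - (A - K) (∑' k, g (u k)) - 0)) :=
    (tendsto_const_nhds.sub (((A - K).continuous.tendsto _).comp hsum.hasSum.tendsto_sum_nat)).sub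
      hu0
  have hz := Z.closed_of_finiteDimensional.mem_of_tendsto hlim (Eventually.of_forall hmem)
  rw [sub_zero] at hz
  rw [← sub_add_cancel y ((A - K) (∑' k, g (u k)))]
  exact Submodule.add_mem_sup hz (LinearMap.mem_range_self ((A - K : X →L[ℂ] X) : X →ₗ[ℂ] X) _)

theorem IsLowerSemiFredholm.add_of_isEssentiallyQuasinilpotent
    {S R : X →L[ℂ] X} (hS : S.IsLowerSemiFredholm) (hR : R.IsEssentiallyQuasinilpotent)
    (hSR : S * R - R * S ∈ finiteRankIdeal X) : (S + R).IsLowerSemiFredholm := by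
  obtain ⟨C, hC, hSC⟩ := hS.exists_isEssentiallyOpen
  -- With `ε = C⁻¹`, the perturbation `(-R) ^ n - F` of `S ^ n` satisfies the smallness condition
  -- for the constant `C ^ n`.
  obtain ⟨n, -, F, hF, hlt⟩ := hR.neg C⁻¹ (inv_pos.mpr hC)
  obtain ⟨Q, -, hQ⟩ := exists_pow_sub_neg_pow_eq hSR n
  have h₁ := (hSC.pow hC.le n).range_sub_coFG (K := (-R) ^ n - F) (pow_nonneg hC.le n) (by
    rwa [inv_pow, ← one_div, lt_div_iff₀ (by positivity)] at hlt)
  have h₂ : (LinearMap.range (((S + R) * Q : X →L[ℂ] X) : X →ₗ[ℂ] X)).CoFG := by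
    refine range_coFG_of_sub_mem ?_ h₁
    have e : S ^ n - ((-R) ^ n - F) - (S + R) * Q = (S ^ n - (-R) ^ n - (S + R) * Q) + F := by abel
    rw [e]
    exact add_mem hQ hF
  refine isLowerSemiFredholm_iff.mpr (h₂.of_le ?_)
  rintro _ ⟨x, rfl⟩
  exact ⟨Q x, rfl⟩

end ContinuousLinearMap

/-! ### The index: finite-rank invariance and local constancy -/

namespace LinearMap

open Module

variable {K V W : Type*} [Field K] [AddCommGroup V] [Module K V] [AddCommGroup W] [Module K W]

/-- The kernel and cokernel dimensions of `f` compared with those of its restriction to a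
subspace `M` of finite codimension. -/
lemma finrank_ker_add_finrank_quotient_map (f : V →ₗ[K] W) (M : Submodule K V)
    [FiniteDimensional K (V ⧸ M)] [FiniteDimensional K (ker f)]
    [FiniteDimensional K (W ⧸ range f)] :
    finrank K (ker f) + finrank K (W ⧸ M.map f) =
      finrank K (M ⊓ ker f : Submodule K V) + finrank K (W ⧸ range f) + finrank K (V ⧸ M) := by
  -- Dimension count along the exact sequence `0 → M ⊓ ker f → ker f → V ⧸ M → W ⧸ f(M) → W ⧸ range
  -- f → 0`, whose middle maps are `ψ` and `φ`.
  let φ : V ⧸ M →ₗ[K] W ⧸ M.map f := M.mapQ (M.map f) f (Submodule.le_comap_map f M)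
  have h₁ := φ.finrank_range_add_finrank_ker
  have h₂ := Submodule.finrank_quotient_add_finrank (range φ)
  have hrange : range φ = (range f).map (M.map f).mkQ := by
    rw [Submodule.range_mapQ]
  have h₃ : finrank K ((W ⧸ M.map f) ⧸ range φ) = finrank K (W ⧸ range f) := by
    rw [hrange]
    exact (Submodule.quotientQuotientEquivQuotient (M.map f) (range f)
      (map_le_range)).finrank_eq
  let ψ : ker f →ₗ[K] V ⧸ M := M.mkQ ∘ₗ (ker f).subtype
  have h₄ := ψ.finrank_range_add_finrank_ker
  have h₅ : range ψ = ker φ := by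
    rw [range_comp, Submodule.range_subtype]
    ext v
    obtain ⟨v, rfl⟩ := M.mkQ_surjective v
    constructor
    · rintro ⟨k, hk, hkv⟩
      rw [← hkv]
      have : f k = 0 := hk
      simp [φ, this]
    · intro hv
      have hv' : f v ∈ M.map f := by
        simpa [φ, Submodule.Quotient.mk_eq_zero] using hv
      obtain ⟨m, hm, hmv⟩ := hv'
      refine ⟨v - m, by simp [hmv], ?_⟩
      rw [map_sub, Submodule.mkQ_apply _ m, (Submodule.Quotient.mk_eq_zero M).mpr hm, sub_zero]
  have h₆ : finrank K (ker ψ) = finrank K (M ⊓ ker f : Submodule K V) := by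
    have e : ker ψ = M.comap (ker f).subtype := by rw [ker_comp, Submodule.ker_mkQ]
    rw [e, ← Submodule.finrank_map_subtype_eq, Submodule.map_comap_subtype, inf_comm]
  rw [h₅] at h₄
  omega

/-- The difference between the dimensions of the kernel and the cokernel. -/
def fredholmIndex (f : V →ₗ[K] W) : ℤ := finrank K (ker f) - finrank K (W ⧸ range f)

/-- By the dimension count, the index is determined by the restriction to `M` and the codimension of
`M`. -/
lemma fredholmIndex_eq_of_eqOn {f g : V →ₗ[K] W} {M : Submodule K V} (hM : M.CoFG)
    (h : Set.EqOn f g M) [FiniteDimensional K (ker f)] [FiniteDimensional K (W ⧸ range f)]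
    [FiniteDimensional K (ker g)] [FiniteDimensional K (W ⧸ range g)] :
    f.fredholmIndex = g.fredholmIndex := by
  have h₁ := f.finrank_ker_add_finrank_quotient_map M
  have h₂ := g.finrank_ker_add_finrank_quotient_map M
  have h₃ : M.map f = M.map g := SetLike.coe_injective (Set.EqOn.image_eq h)
  have h₄ : M ⊓ ker f = M ⊓ ker g := by
    ext x
    simp only [Submodule.mem_inf, mem_ker]
    exact and_congr_right fun hx ↦ by rw [h hx]
  rw [h₃, h₄] at h₁
  unfold fredholmIndex
  omega

lemma fredholmIndex_equiv_comp {U : Type*} [AddCommGroup U] [Module K U] (f : V →ₗ[K] W)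
    (e : W ≃ₗ[K] U) : ((e : W →ₗ[K] U) ∘ₗ f).fredholmIndex = f.fredholmIndex := by
  have h : finrank K (U ⧸ range ((e : W →ₗ[K] U) ∘ₗ f)) = finrank K (W ⧸ range f) := by
    rw [range_comp]
    exact (Submodule.Quotient.equiv (range f) _ e rfl).finrank_eq.symm
  rw [fredholmIndex, fredholmIndex, h, LinearEquiv.ker_comp]

end LinearMap

namespace ContinuousLinearMap

open Module

variable {X : Type*} [NormedAddCommGroup X] [NormedSpace ℂ X]

/-- The index of `A`, meaningful if `A` is Fredholm. -/
def index (A : X →L[ℂ] X) : ℤ := (A : X →ₗ[ℂ] X).fredholmIndex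

lemma IsFredholm.extIndex_eq {A : X →L[ℂ] X} (hA : A.IsFredholm) :
    A.extIndex = ((A.index : ℝ) : EReal) := by
  have := hA.finite_ker
  have := hA.finite_coker
  have h₁ : A.nullity = (finrank ℂ (LinearMap.ker (A : X →ₗ[ℂ] X)) : ℕ∞) := by
    rw [nullity, ← finrank_eq_rank, Cardinal.toENat_nat]
  have h₂ : A.deficiency = (finrank ℂ (X ⧸ LinearMap.range (A : X →ₗ[ℂ] X)) : ℕ∞) := by
    rw [deficiency, ← finrank_eq_rank, Cardinal.toENat_nat]
  have hcast (n : ℕ) : (((n : ℕ∞) : ℝ≥0∞) : EReal) = ((n : ℝ) : EReal) := by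
    rw [ENat.toENNReal_coe]; rfl
  rw [extIndex, index, LinearMap.fredholmIndex, h₁, h₂, hcast, hcast, ← EReal.coe_sub]
  push_cast
  rfl

lemma IsFredholm.of_sub_mem {A B : X →L[ℂ] X} (hA : A.IsFredholm)
    (hAB : A - B ∈ finiteRankIdeal X) : B.IsFredholm := by
  obtain ⟨V, h₁, h₂⟩ := hA.exists_mul_sub_one_mem
  refine .of_mul_sub_one_mem (V := V) ?_ ?_
  · have e : V * B - 1 = (V * A - 1) - V * (A - B) := by rw [mul_sub]; abel
    rw [e]
    exact sub_mem h₁ ((finiteRankIdeal X).mul_mem_left V hAB)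
  · have e : B * V - 1 = (A * V - 1) - (A - B) * V := by rw [sub_mul]; abel
    rw [e]
    exact sub_mem h₂ ((finiteRankIdeal X).mul_mem_right V hAB)

lemma IsFredholm.index_eq_of_sub_mem {A B : X →L[ℂ] X} (hA : A.IsFredholm)
    (hAB : A - B ∈ finiteRankIdeal X) : B.index = A.index := by
  have hB := hA.of_sub_mem hAB
  have := hA.finite_ker
  have := hA.finite_coker
  have := hB.finite_ker
  have := hB.finite_coker
  refine (LinearMap.fredholmIndex_eq_of_eqOn (ker_coFG_of_mem_finiteRankIdeal hAB)
    fun x hx ↦ ?_).symm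
  exact sub_eq_zero.mp hx

lemma index_units_mul (U : (X →L[ℂ] X)ˣ) (A : X →L[ℂ] X) : (U * A : X →L[ℂ] X).index = A.index :=
  (A : X →ₗ[ℂ] X).fredholmIndex_equiv_comp (ContinuousLinearEquiv.ofUnit U).toLinearEquiv

lemma IsFredholm.units_mul (U : (X →L[ℂ] X)ˣ) {A : X →L[ℂ] X} (hA : A.IsFredholm) :
    (U * A : X →L[ℂ] X).IsFredholm := by
  obtain ⟨V, h₁, h₂⟩ := hA.exists_mul_sub_one_mem
  refine .of_mul_sub_one_mem (V := V * (↑U⁻¹ : X →L[ℂ] X)) ?_ ?_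
  · simpa [mul_assoc] using h₁
  · have e : (U : X →L[ℂ] X) * A * (V * (↑U⁻¹ : X →L[ℂ] X)) - 1 =
        U * (A * V - 1) * (↑U⁻¹ : X →L[ℂ] X) := by
      simp [mul_sub, sub_mul, mul_assoc]
    rw [e]
    exact (finiteRankIdeal X).mul_mem_right _ ((finiteRankIdeal X).mul_mem_left _ h₂)

lemma neg_add_comm_mem {S R : X →L[ℂ] X} (hSR : S * R - R * S ∈ finiteRankIdeal X) :
    (S + R) * (-R) - (-R) * (S + R) ∈ finiteRankIdeal X := by
  have e : (S + R) * (-R) - (-R) * (S + R) = -(S * R - R * S) := by noncomm_ring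
  rw [e]
  exact neg_mem hSR

/-- Invariance of a spectrum under an essentially commuting Riesz perturbation, for a class `P` of
operators stable under such perturbations. -/
lemma setOf_not_eq_of_stable {P : (X →L[ℂ] X) → Prop}
    (hP : ∀ {S R : X →L[ℂ] X}, P S → R.IsEssentiallyQuasinilpotent →
      S * R - R * S ∈ finiteRankIdeal X → P (S + R))
    {T R : X →L[ℂ] X} (hR : R.IsEssentiallyQuasinilpotent)
    (hTR : T * R - R * T ∈ finiteRankIdeal X) :
    {z : ℂ | ¬ P (T - z • ContinuousLinearMap.id ℂ X)} =
      {z : ℂ | ¬ P (T + R - z • ContinuousLinearMap.id ℂ X)} := by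
  ext z
  have e : (T - z • ContinuousLinearMap.id ℂ X) + R = T + R - z • ContinuousLinearMap.id ℂ X := by
    abel
  have hz : (T - z • ContinuousLinearMap.id ℂ X) * R - R * (T - z • ContinuousLinearMap.id ℂ X) ∈
      finiteRankIdeal X := by
    have e' : (T - z • ContinuousLinearMap.id ℂ X) * R -
        R * (T - z • ContinuousLinearMap.id ℂ X) = T * R - R * T := by
      ext x
      simp
    rwa [e']
  -- The converse perturbs `S + R` back by `-R`, which satisfies the same hypotheses.
  refine not_congr ⟨fun h ↦ e ▸ hP h hR hz, fun h ↦ ?_⟩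
  rw [← e] at h
  simpa using hP h hR.neg (neg_add_comm_mem hz)

variable [CompleteSpace X]

/-- The index is locally constant on Fredholm operators. -/
lemma IsFredholm.eventually_index_eq {A : X →L[ℂ] X} (hA : A.IsFredholm) :
    ∀ᶠ B in 𝓝 A, B.index = A.index := by
  obtain ⟨V, h₁, -⟩ := hA.exists_mul_sub_one_mem
  -- For `B` near `A` this is a unit `U`, and `U * A` differs from `B` by the finite-rank operator
  -- `(B - A) * (V * A - 1)`.
  have hcont : Continuous fun B : X →L[ℂ] X ↦ 1 + (B - A) * V := by fun_prop
  have hev : ∀ᶠ B in 𝓝 A, IsUnit (1 + (B - A) * V) :=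
    (hcont.tendsto A).eventually (Units.isOpen.mem_nhds (by simp))
  filter_upwards [hev] with B ⟨U, hU⟩
  rw [← index_units_mul U A]
  refine (hA.units_mul U).index_eq_of_sub_mem ?_
  have e : (U : X →L[ℂ] X) * A - B = (B - A) * (V * A - 1) := by
    rw [hU, add_mul, one_mul, mul_sub, mul_assoc, mul_one]
    abel
  rw [e]
  exact (finiteRankIdeal X).mul_mem_left _ h₁

lemma index_eq_of_forall_isFredholm {S R : X →L[ℂ] X}
    (h : ∀ t : ℝ, (S + (t : ℂ) • R).IsFredholm) : (S + R).index = S.index := by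
  have hloc : IsLocallyConstant fun t : ℝ ↦ (S + (t : ℂ) • R).index := by
    rw [IsLocallyConstant.iff_eventually_eq]
    intro t
    have hcont : Continuous fun t : ℝ ↦ S + (t : ℂ) • R := by fun_prop
    exact (hcont.tendsto t).eventually (h t).eventually_index_eq
  simpa using hloc.apply_eq_of_preconnectedSpace 1 0

theorem isFredholm_iff {A : X →L[ℂ] X} :
    A.IsFredholm ↔ A.IsUpperSemiFredholm ∧ A.IsLowerSemiFredholm := by
  constructor
  · intro h
    exact ⟨⟨nullity_lt_top_iff.mpr h.finite_ker, h.isClosed_range⟩,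
      isLowerSemiFredholm_iff.mpr h.finite_coker⟩
  · rintro ⟨h₁, h₂⟩
    have hker := nullity_lt_top_iff.mp h₁.nullity_lt_top
    have hcl : IsClosed ((A : X →ₗ[ℂ] X).range : Set X) := h₁.isClosed_range
    have : CompleteSpace (A : X →ₗ[ℂ] X).range := hcl.completeSpace_coe
    refine ⟨?_, hcl, hker, isLowerSemiFredholm_iff.mp h₂, .of_finiteDimensional _⟩
    -- Strictness is the open mapping theorem for the corestriction of `A` to its closed range.
    exact IsEmbedding.subtypeVal.isStrictMap_iff.mp
      (A.rangeRestrict.isQuotientMap (A : X →ₗ[ℂ] X).surjective_rangeRestrict).isStrictMap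

/-! ### Stability of the Fredholm and Weyl classes -/

section Perturbation

variable {S R : X →L[ℂ] X}

theorem IsFredholm.add_of_isEssentiallyQuasinilpotent (hS : S.IsFredholm)
    (hR : R.IsEssentiallyQuasinilpotent) (hSR : S * R - R * S ∈ finiteRankIdeal X) :
    (S + R).IsFredholm := by
  rw [isFredholm_iff] at hS ⊢
  exact ⟨hS.1.add_of_isEssentiallyQuasinilpotent hR hSR,
    hS.2.add_of_isEssentiallyQuasinilpotent hR hSR⟩

theorem IsFredholm.index_add_of_isEssentiallyQuasinilpotent (hS : S.IsFredholm)
    (hR : R.IsEssentiallyQuasinilpotent) (hSR : S * R - R * S ∈ finiteRankIdeal X) :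
    (S + R).index = S.index := by
  refine index_eq_of_forall_isFredholm fun t ↦
    hS.add_of_isEssentiallyQuasinilpotent (hR.smul t) ?_
  rw [mul_smul_comm, smul_mul_assoc, ← smul_sub]
  exact LinearMap.HasFiniteRange.smul hSR _

theorem IsWeyl.add_of_isEssentiallyQuasinilpotent (hS : S.IsWeyl)
    (hR : R.IsEssentiallyQuasinilpotent) (hSR : S * R - R * S ∈ finiteRankIdeal X) :
    (S + R).IsWeyl := by
  have h := hS.1.add_of_isEssentiallyQuasinilpotent hR hSR
  refine ⟨h, ?_⟩
  rw [h.extIndex_eq, hS.1.index_add_of_isEssentiallyQuasinilpotent hR hSR, ← hS.1.extIndex_eq]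
  exact hS.2

theorem IsUpperSemiWeyl.add_of_isEssentiallyQuasinilpotent (hS : S.IsUpperSemiWeyl)
    (hR : R.IsEssentiallyQuasinilpotent) (hSR : S * R - R * S ∈ finiteRankIdeal X) :
    (S + R).IsUpperSemiWeyl := by
  have h := hS.1.add_of_isEssentiallyQuasinilpotent hR hSR
  refine ⟨h, ?_⟩
  by_cases hl : (S + R).IsLowerSemiFredholm
  · have hf : (S + R).IsFredholm := isFredholm_iff.mpr ⟨h, hl⟩
    have hf' : S.IsFredholm := by
      simpa using hf.add_of_isEssentiallyQuasinilpotent hR.neg (neg_add_comm_mem hSR)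
    rw [hf.extIndex_eq, hf'.index_add_of_isEssentiallyQuasinilpotent hR hSR, ← hf'.extIndex_eq]
    exact hS.2
  -- Failing to be lower semi-Fredholm forces infinite deficiency, since finite codimension already
  -- makes the range closed; the index is then `-∞`.
  · have hd : (S + R).deficiency = ⊤ := by
      by_contra hd
      exact hl (isLowerSemiFredholm_iff.mpr (deficiency_lt_top_iff.mp (lt_top_iff_ne_top.mpr hd)))
    simp [extIndex, hd, EReal.sub_top]

theorem IsLowerSemiWeyl.add_of_isEssentiallyQuasinilpotent (hS : S.IsLowerSemiWeyl)
    (hR : R.IsEssentiallyQuasinilpotent) (hSR : S * R - R * S ∈ finiteRankIdeal X) :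
    (S + R).IsLowerSemiWeyl := by
  have h := hS.1.add_of_isEssentiallyQuasinilpotent hR hSR
  refine ⟨h, ?_⟩
  by_cases hn : (S + R).nullity < ⊤
  · have hf : (S + R).IsFredholm := isFredholm_iff.mpr ⟨⟨hn, h.isClosed_range⟩, h⟩
    have hf' : S.IsFredholm := by
      simpa using hf.add_of_isEssentiallyQuasinilpotent hR.neg (neg_add_comm_mem hSR)
    rw [hf.extIndex_eq, hf'.index_add_of_isEssentiallyQuasinilpotent hR hSR, ← hf'.extIndex_eq]
    exact hS.2
  · obtain ⟨d, hd⟩ := ENat.ne_top_iff_exists.mp h.deficiency_lt_top.ne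
    have hn' : (S + R).nullity = ⊤ := not_lt_top_iff.mp hn
    rw [extIndex, hn', ← hd]
    simp

end Perturbation

end ContinuousLinearMap

end

/-! ### The commutator has finite rank; conclusion -/

theorem mainTheorem10 {X : Type*} [NormedAddCommGroup X] [NormedSpace ℂ X] [CompleteSpace X]
    (T R : X →L[ℂ] X) (hR : R.IsRiesz) :
    (Commute T (R * T) → Commute T (T * R) → T.IsFredholm →
      T.essSpectrum = (T + R).essSpectrum ∧ T.weylSpectrum = (T + R).weylSpectrum) ∧
    (Commute T (T * R) → T.IsUpperSemiFredholm →
      T.upperSemiFredholmSpectrum = (T + R).upperSemiFredholmSpectrum ∧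
      T.upperSemiWeylSpectrum = (T + R).upperSemiWeylSpectrum) ∧
    (Commute T (R * T) → T.IsLowerSemiFredholm →
      T.lowerSemiFredholmSpectrum = (T + R).lowerSemiFredholmSpectrum ∧
      T.lowerSemiWeylSpectrum = (T + R).lowerSemiWeylSpectrum) := by
  have hq := hR.isEssentiallyQuasinilpotent
  have hupper : Commute T (T * R) → T.IsUpperSemiFredholm →
      T * R - R * T ∈ ContinuousLinearMap.finiteRankIdeal X := by
    intro hc hT
    have := ContinuousLinearMap.nullity_lt_top_iff.mp hT.nullity_lt_top
    have hle : LinearMap.range ((T * R - R * T : X →L[ℂ] X) : X →ₗ[ℂ] X) ≤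
        LinearMap.ker (T : X →ₗ[ℂ] X) := by
      rintro _ ⟨x, rfl⟩
      have h : T * (T * R - R * T) = 0 := by rw [mul_sub, sub_eq_zero, ← mul_assoc T R T]; exact hc
      exact congr($h x)
    have := Submodule.finiteDimensional_of_le hle
    exact Submodule.FG.of_finite
  have hlower : Commute T (R * T) → T.IsLowerSemiFredholm →
      T * R - R * T ∈ ContinuousLinearMap.finiteRankIdeal X := by
    intro hc hT
    have hle : LinearMap.range (T : X →ₗ[ℂ] X) ≤
        LinearMap.ker ((T * R - R * T : X →L[ℂ] X) : X →ₗ[ℂ] X) := by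
      rintro _ ⟨x, rfl⟩
      have h : (T * R - R * T) * T = 0 := by rw [sub_mul, sub_eq_zero, mul_assoc T R T]; exact hc
      exact congr($h x)
    exact LinearMap.ker_coFG_iff_hasFiniteRange.mp
      ((ContinuousLinearMap.isLowerSemiFredholm_iff.mp hT).of_le hle)
  refine ⟨fun _ hc hT ↦ ?_, fun hc hT ↦ ?_, fun hc hT ↦ ?_⟩
  · have h := hupper hc (ContinuousLinearMap.isFredholm_iff.mp hT).1
    exact ⟨ContinuousLinearMap.setOf_not_eq_of_stable
        ContinuousLinearMap.IsFredholm.add_of_isEssentiallyQuasinilpotent hq h,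
      ContinuousLinearMap.setOf_not_eq_of_stable
        ContinuousLinearMap.IsWeyl.add_of_isEssentiallyQuasinilpotent hq h⟩
  · have h := hupper hc hT
    exact ⟨ContinuousLinearMap.setOf_not_eq_of_stable
        ContinuousLinearMap.IsUpperSemiFredholm.add_of_isEssentiallyQuasinilpotent hq h,
      ContinuousLinearMap.setOf_not_eq_of_stable
        ContinuousLinearMap.IsUpperSemiWeyl.add_of_isEssentiallyQuasinilpotent hq h⟩
  · have h := hlower hc hT
    exact ⟨ContinuousLinearMap.setOf_not_eq_of_stable
        ContinuousLinearMap.IsLowerSemiFredholm.add_of_isEssentiallyQuasinilpotent hq h,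
      ContinuousLinearMap.setOf_not_eq_of_stable
        ContinuousLinearMap.IsLowerSemiWeyl.add_of_isEssentiallyQuasinilpotent hq h⟩
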